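/- Let $d$ be a natural number and let $P_{\mathbf X}$ be a probability distribution on $\mathbb R^d$ of the form $$P_{\mathbf X}=\alpha P_{\mathbf X_C}+(1-\alpha)P_{\mathbf X_D},\qquad 0\le\alpha\le 1,$$ where $P_{\mathbf X_C}$ is a probability distribution that is absolutely continuous with respect to $d$-dimensional Lebesgue measure and $P_{\mathbf X_D}$ is a purely discrete probability distribution, i.e. one carried by a countable set. For $\eta>0$ let $\mathbf Y=\mathbf X+\mathbf N$, where $\mathbf X\sim P_{\mathbf X}$ and $\mathbf N\sim\mathcal N(\mathbf 0,\eta I_d)$ are independent, and let $P_{\mathbf Y|\mathbf X}(\cdot|\mathbf x)=\mathcal N(\mathbf x,\eta I_d)$. For an integer $M\ge 2$ and $\mathcal U=(\mathbf u_0,\dots,\mathbf u_{M-1})$ with $\mathbf u_k\in\mathbb R^d$, let $\mu_{\mathcal U}=\sum_{k=0}^{M-1}P_{\mathbf X-\mathbf u_k}$ and $p_k(\mathbf x)=\frac{dP_{\mathbf X-\mathbf u_k}}{d\mu_{\mathcal U}}(\mathbf x)$, and let $P_e(\mathbf x;\mathcal U)$ be the minimum probability of error, over all measurable decision rules based on $\mathbf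 Y$, in the $M$-ary hypothesis testing problem $\mathcal H_k:\mathbf Y\sim P_{\mathbf Y|\mathbf X}(\cdot|\mathbf x+\mathbf u_k)$ with prior probabilities $\Pr(\mathcal H_k)=p_k(\mathbf x)$, $k=0,\dots,M-1$. For $t>0$ and $i\in\{1,\dots,d\}$ put $$\mathsf h(t,i,M)=\sup_{\mathcal U:\ (\mathbf u_k)_i=kt\ \forall k}\ \int P_e(\mathbf x;\mathcal U)\,d\mu_{\mathcal U}(\mathbf x),$$ and define the Ziv-Zakai bound without valley-filling function as $$\mathsf{ZZ}(P_{\mathbf X},P_{\mathbf Y|\mathbf X},M)=\sum_{i=1}^d\int_0^\infty\frac t2\,\frac{\mathsf h(t,i,M)}{M-1}\,dt .$$ Let also $\mathrm{mmse}(\mathbf X|\mathbf Y)=\sum_{i=1}^d\mathbb E\big[(X_i-\mathbb E[X_i|\mathbf Y])^2\big]$, where $\mathbb E[X_i|\mathbf Y]$ is the mean of the conditional distribution of $X_i$ given $\mathbf Y$. Then $$\lim_{\eta\to0^+}\frac{\mathsf{ZZ}(P_{\mathbf X},P_{\mathbf Y|\mathbf X},2)}{\eta}=\alpha d .$$ Moreover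 this simplest Ziv-Zakai bound ($M=2$, no valley-filling) is tight in the low-noise limit, in the sense that also $$\lim_{\eta\to0^+}\frac{\mathrm{mmse}(\mathbf X|\mathbf Y)}{\eta}=\alpha d .$$ -/

import Mathlib

open MeasureTheory ProbabilityTheory Filter Topology
open scoped ENNReal

namespace ZivZakai

noncomputable section

/-- A measure is purely discrete (purely discontinuous) if it is carried by a countable set. -/
def IsPurelyDiscrete {𝒳 : Type*} [MeasurableSpace 𝒳] (P : Measure 𝒳) : Prop :=
  ∃ S : Set 𝒳, S.Countable ∧ P Sᶜ = 0

/-- Minimum probability of error, over all measurable decision rules `φ`, in the `M`-ary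
hypothesis testing problem `H_k : Y ∼ κ (x + u k)` with prior weights `p k`. -/
def minErrorProb {d M : ℕ} {𝒴 : Type*} [MeasurableSpace 𝒴]
    (κ : Kernel (EuclideanSpace ℝ (Fin d)) 𝒴) (x : EuclideanSpace ℝ (Fin d))
    (p : Fin M → ℝ≥0∞) (u : Fin M → EuclideanSpace ℝ (Fin d)) : ℝ≥0∞ :=
  ⨅ (φ : 𝒴 → Fin M) (_ : Measurable φ), ∑ k, p k * κ (x + u k) {y | φ y ≠ k}

/-- The law of `X - v`, where `X ∼ P`. -/
def shiftLaw {d : ℕ} (P : Measure (EuclideanSpace ℝ (Fin d))) (v : EuclideanSpace ℝ (Fin d)) :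
    Measure (EuclideanSpace ℝ (Fin d)) :=
  P.map (fun x => x - v)

/-- The measure `μ_U = ∑_k P_{X - u_k}`. -/
def muU {d M : ℕ} (P : Measure (EuclideanSpace ℝ (Fin d)))
    (u : Fin M → EuclideanSpace ℝ (Fin d)) : Measure (EuclideanSpace ℝ (Fin d)) :=
  ∑ k, shiftLaw P (u k)

/-- The prior weights `p_k = dP_{X - u_k} / dμ_U (x)`. -/
def priorU {d M : ℕ} (P : Measure (EuclideanSpace ℝ (Fin d)))
    (u : Fin M → EuclideanSpace ℝ (Fin d)) (x : EuclideanSpace ℝ (Fin d)) : Fin M → ℝ≥0∞ :=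
  fun k => (shiftLaw P (u k)).rnDeriv (muU P u) x

/-- `h(t, i, M)`: the supremum, over all `u_0, …, u_{M-1}` with `(u_k)_i = k t`, of the error
probability integrated against `μ_U`. -/
def hZZ {d : ℕ} {𝒴 : Type*} [MeasurableSpace 𝒴] (P : Measure (EuclideanSpace ℝ (Fin d)))
    (κ : Kernel (EuclideanSpace ℝ (Fin d)) 𝒴) (t : ℝ) (i : Fin d) (M : ℕ) : ℝ≥0∞ :=
  ⨆ (u : Fin M → EuclideanSpace ℝ (Fin d)) (_ : ∀ k, u k i = ((k : ℕ) : ℝ) * t),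
    ∫⁻ x, minErrorProb κ x (priorU P u x) u ∂(muU P u)

/-- The Ziv-Zakai bound with `M ≥ 2` hypotheses and without valley-filling function, for the
input law `P` and the channel `κ`. -/
def ZZ {d : ℕ} {𝒴 : Type*} [MeasurableSpace 𝒴] (P : Measure (EuclideanSpace ℝ (Fin d)))
    (κ : Kernel (EuclideanSpace ℝ (Fin d)) 𝒴) (M : ℕ) : ℝ≥0∞ :=
  ∑ i, ∫⁻ t in Set.Ioi (0 : ℝ), ENNReal.ofReal (t / 2) * (hZZ P κ t i M / ((M : ℝ≥0∞) - 1))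

/-- The minimum mean squared error `∑_i E[(X_i - E[X_i | Y])²]`, where `X ∼ P` and `Y` given
`X = x` has law `κ x`; `E[X_i | Y = y]` is the mean of the regular conditional distribution of `X`
given `Y = y`, so that `X` itself need not be integrable. -/
def mmse {d : ℕ} {𝒴 : Type*} [MeasurableSpace 𝒴] (P : Measure (EuclideanSpace ℝ (Fin d)))
    [IsFiniteMeasure P] (κ : Kernel (EuclideanSpace ℝ (Fin d)) 𝒴) [IsFiniteKernel κ] : ℝ≥0∞ :=
  ∑ i, ∫⁻ z, ENNReal.ofReal ((z.1 i - ∫ x, x i ∂(posterior κ P z.2)) ^ 2) ∂(P ⊗ₘ κ)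

/-- The additive Gaussian noise channel: given the input `x`, the output is `x + N` with
`N ∼ 𝒩(0, η I_d)`. -/
def awgn (d : ℕ) (η : ℝ) : Kernel (EuclideanSpace ℝ (Fin d)) (EuclideanSpace ℝ (Fin d)) where
  toFun x := (multivariateGaussian 0 (η • (1 : Matrix (Fin d) (Fin d) ℝ))).map (fun n => x + n)
  measurable' := by
    refine Measure.measurable_of_measurable_coe _ fun s hs => ?_
    have h : ∀ x : EuclideanSpace ℝ (Fin d),
        ((multivariateGaussian 0 (η • (1 : Matrix (Fin d) (Fin d) ℝ))).map (fun n => x + n)) s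
          = multivariateGaussian 0 (η • (1 : Matrix (Fin d) (Fin d) ℝ))
              (Prod.mk x ⁻¹' ((fun p : EuclideanSpace ℝ (Fin d) × EuclideanSpace ℝ (Fin d) =>
                p.1 + p.2) ⁻¹' s)) := fun x => by
      rw [Measure.map_apply (by fun_prop) hs]; rfl
    simp_rw [h]
    exact measurable_measure_prodMk_left ((measurable_fst.add measurable_snd) hs)

instance instIsMarkovKernelAwgn (d : ℕ) (η : ℝ) : IsMarkovKernel (awgn d η) :=
  ⟨fun x => by
    change IsProbabilityMeasure
      ((multivariateGaussian 0 (η • (1 : Matrix (Fin d) (Fin d) ℝ))).map (fun n => x + n))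
    exact Measure.isProbabilityMeasure_map (by fun_prop)⟩

end

end ZivZakai

/-!
Both limits follow from a sandwich. Write `Y = X + √η Z` with `Z` standard Gaussian.

*The bound lies below the mmse* (`ZZ_two_le_mmse`). Deciding between two shifts that are `t` apart
in coordinate `i` by thresholding the posterior mean of `X_i` errs only if that mean is off by at
least `t / 2`; integrating over `t` turns this tail probability into the second moment of the error.

*The mmse is at most `α d η` to first order* (`limsup_mmse_awgn_le`). The posterior mean beats every
estimator, in particular the one that replaces `Y` by an atom of a finite set `F` if that atom lies
within `K √η` of `Y`. As `η → 0` its error is eventually zero if `X ∈ F` and `‖Z‖ ≤ K`, and `√η Z`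
otherwise, so by dominated convergence the normalized error in each coordinate tends to at most
`P(Fᶜ)` plus a Gaussian tail beyond `K`. Let `F` exhaust a countable carrier `S` of the discrete
part and `K → ∞`: what remains is `P(Sᶜ) ≤ α`.

*The Ziv-Zakai bound is at least `α d η` to first order* (`le_liminf_ZZ_awgn`). Take `u_0 = 0` and
`u_1 = t e_i`. By the Cameron-Martin formula the likelihood ratio of the two outputs is monotone in
coordinate `i`, so the error probability is at least the smaller prior weight times
`P(2 √η |Z_i| > t)`. The smaller prior weight integrates to at least `α` times the mass that the
density of the absolutely continuous part shares with its translate by `t e_i`, which tends to `1`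
with `t → 0` because translation is continuous in `L¹`. Only `t` of order `√η` matters, and
`∫ (t / 2) P(2 √η |Z_i| > t) dt = η`.
-/

namespace ZivZakai

/-! ### The Ziv-Zakai bound is a lower bound for the mmse -/

section

variable {d : ℕ} {𝒴 : Type*} [MeasurableSpace 𝒴]

lemma measurable_kernel_shift (κ : Kernel (EuclideanSpace ℝ (Fin d)) 𝒴) [IsFiniteKernel κ]
    (v : EuclideanSpace ℝ (Fin d)) {s : Set (EuclideanSpace ℝ (Fin d) × 𝒴)}
    (hs : MeasurableSet s) : Measurable fun x => κ (x + v) (Prod.mk x ⁻¹' s) :=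
  Kernel.measurable_kernel_prodMk_left (κ := κ.comap (fun x => x + v) (by fun_prop)) hs

lemma shiftLaw_le_muU {M : ℕ} (P : Measure (EuclideanSpace ℝ (Fin d)))
    (u : Fin M → EuclideanSpace ℝ (Fin d)) (k : Fin M) : shiftLaw P (u k) ≤ muU P u := by
  intro s
  rw [muU, Measure.finsetSum_apply]
  exact Finset.single_le_sum (f := fun k => shiftLaw P (u k) s) (fun _ _ => zero_le)
    (Finset.mem_univ k)

instance isFiniteMeasure_shiftLaw (P : Measure (EuclideanSpace ℝ (Fin d))) [IsFiniteMeasure P]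
    (v : EuclideanSpace ℝ (Fin d)) : IsFiniteMeasure (shiftLaw P v) := by
  unfold shiftLaw; infer_instance

instance isFiniteMeasure_muU {M : ℕ} (P : Measure (EuclideanSpace ℝ (Fin d))) [IsFiniteMeasure P]
    (u : Fin M → EuclideanSpace ℝ (Fin d)) : IsFiniteMeasure (muU P u) := by
  unfold muU; infer_instance

/-- Recorded because instance search on measures over `EuclideanSpace` exceeds its size limit. -/
instance haveLebesgueDecomposition_muU {M : ℕ} (P : Measure (EuclideanSpace ℝ (Fin d)))
    [IsFiniteMeasure P] (u : Fin M → EuclideanSpace ℝ (Fin d)) (k : Fin M) :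
    (shiftLaw P (u k)).HaveLebesgueDecomposition (muU P u) := by
  have : SigmaFinite (shiftLaw P (u k)) := IsFiniteMeasure.toSigmaFinite _
  have : SigmaFinite (muU P u) := IsFiniteMeasure.toSigmaFinite _
  exact Measure.haveLebesgueDecomposition_of_sigmaFinite _ _

/-- Weighting by the prior `p_k` and integrating against `μ_U` is averaging over `X - u_k`. -/
lemma lintegral_priorU_mul {M : ℕ} (P : Measure (EuclideanSpace ℝ (Fin d))) [IsFiniteMeasure P]
    (u : Fin M → EuclideanSpace ℝ (Fin d)) (k : Fin M) {f : EuclideanSpace ℝ (Fin d) → ℝ≥0∞}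
    (hf : Measurable f) :
    ∫⁻ x, priorU P u x k * f x ∂(muU P u) = ∫⁻ x, f (x - u k) ∂P := by
  unfold priorU
  rw [lintegral_rnDeriv_mul (Measure.absolutelyContinuous_of_le (shiftLaw_le_muU P u k))
    hf.aemeasurable, shiftLaw, lintegral_map hf (by fun_prop)]

/-- Deciding between two shifts that are `t` apart in coordinate `i` by thresholding an estimate
`m` of `X_i` errs only if the estimate is off by at least `t / 2`. -/
lemma lintegral_minErrorProb_two_le (P : Measure (EuclideanSpace ℝ (Fin d))) [IsFiniteMeasure P]
    (κ : Kernel (EuclideanSpace ℝ (Fin d)) 𝒴) [IsFiniteKernel κ] {m : 𝒴 → ℝ} (hm : Measurable m)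
    (i : Fin d) {t : ℝ} (ht : 0 < t) (u : Fin 2 → EuclideanSpace ℝ (Fin d))
    (hu : ∀ k, u k i = ((k : ℕ) : ℝ) * t) :
    ∫⁻ x, minErrorProb κ x (priorU P u x) u ∂(muU P u)
      ≤ (P ⊗ₘ κ) {z | t / 2 ≤ |z.1 i - m z.2|} := by
  have hu0 : u 0 i = 0 := by simpa using hu 0
  have hu1 : u 1 i = t := by simpa using hu 1
  have hS0 : MeasurableSet {z : EuclideanSpace ℝ (Fin d) × 𝒴 | z.1 i + t / 2 < m z.2} :=
    measurableSet_lt (by fun_prop) (by fun_prop)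
  have hS1 : MeasurableSet {z : EuclideanSpace ℝ (Fin d) × 𝒴 | m z.2 ≤ z.1 i + t / 2} :=
    measurableSet_le (by fun_prop) (by fun_prop)
  have hS2 : MeasurableSet {z : EuclideanSpace ℝ (Fin d) × 𝒴 | m z.2 ≤ z.1 i - t / 2} :=
    measurableSet_le (by fun_prop) (by fun_prop)
  have hrule : ∀ x, minErrorProb κ x (priorU P u x) u ≤
      priorU P u x 0 * κ (x + u 0) (Prod.mk x ⁻¹' {z | z.1 i + t / 2 < m z.2}) +
      priorU P u x 1 * κ (x + u 1) (Prod.mk x ⁻¹' {z | m z.2 ≤ z.1 i + t / 2}) := by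
    intro x
    refine (iInf₂_le (fun y => if x i + t / 2 < m y then (1 : Fin 2) else 0)
      (Measurable.ite (measurableSet_lt measurable_const hm) measurable_const
        measurable_const)).trans ?_
    rw [Fin.sum_univ_two]
    refine add_le_add (mul_le_mul_right (measure_mono fun y hy => ?_) _)
      (mul_le_mul_right (measure_mono fun y hy => ?_) _)
    · by_contra h
      simp_all
    · by_contra h
      simp_all
  calc ∫⁻ x, minErrorProb κ x (priorU P u x) u ∂(muU P u)
      ≤ _ := lintegral_mono hrule
    _ = (P ⊗ₘ κ) {z | z.1 i + t / 2 < m z.2} + (P ⊗ₘ κ) {z | m z.2 ≤ z.1 i - t / 2} := by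
        rw [lintegral_add_left (f := fun x => priorU P u x 0 * _)
            ((Measure.measurable_rnDeriv _ _).mul (measurable_kernel_shift κ (u 0) hS0)),
          lintegral_priorU_mul P u 0 (measurable_kernel_shift κ (u 0) hS0),
          lintegral_priorU_mul P u 1 (measurable_kernel_shift κ (u 1) hS1),
          Measure.compProd_apply hS0, Measure.compProd_apply hS2]
        congr 1
        · refine lintegral_congr fun x => ?_
          simp [hu0]
        · refine lintegral_congr fun x => ?_
          rw [sub_add_cancel]
          congr 1
          ext y
          simp only [Set.mem_preimage, Set.mem_ofPred_eq, PiLp.sub_apply, hu1]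
          rw [show x i - t + t / 2 = x i - t / 2 by ring]
    _ = (P ⊗ₘ κ) ({z | z.1 i + t / 2 < m z.2} ∪ {z | m z.2 ≤ z.1 i - t / 2}) := by
        rw [measure_union _ hS2]
        refine Set.disjoint_left.2 fun z h1 h2 => ?_
        simp only [Set.mem_ofPred_eq] at h1 h2
        linarith
    _ ≤ _ := by
        refine measure_mono fun z hz => ?_
        rcases hz with hz | hz <;> simp only [Set.mem_ofPred_eq] at hz ⊢
        · rw [abs_sub_comm]
          exact le_trans (by linarith) (le_abs_self _)
        · exact le_trans (by linarith) (le_abs_self _)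

/-- The layer cake formula for second moments, in the normalization of the Ziv-Zakai bound. -/
lemma lintegral_half_mul_meas_le {Ω : Type*} [MeasurableSpace Ω] (μ : Measure Ω) {f : Ω → ℝ}
    (hf : Measurable f) :
    ∫⁻ t in Set.Ioi (0 : ℝ), ENNReal.ofReal (t / 2) * μ {ω | t / 2 ≤ |f ω|}
      = ∫⁻ ω, ENNReal.ofReal (f ω ^ 2) ∂μ := by
  have h := lintegral_rpow_eq_lintegral_meas_le_mul μ (f := fun ω => 2 * |f ω|)
    (ae_of_all _ fun ω => by positivity) (by fun_prop) (p := 2) two_pos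
  have h1 : ∫⁻ ω, ENNReal.ofReal ((2 * |f ω|) ^ (2 : ℝ)) ∂μ
      = 4 * ∫⁻ ω, ENNReal.ofReal (f ω ^ 2) ∂μ := by
    rw [← lintegral_const_mul _ (by fun_prop)]
    refine lintegral_congr fun ω => ?_
    rw [Real.rpow_two, mul_pow, sq_abs, ENNReal.ofReal_mul (by norm_num)]
    norm_num
  have h2 : ENNReal.ofReal 2 * ∫⁻ t in Set.Ioi (0 : ℝ),
      μ {ω | t ≤ 2 * |f ω|} * ENNReal.ofReal (t ^ ((2 : ℝ) - 1))
      = 4 * ∫⁻ t in Set.Ioi (0 : ℝ), ENNReal.ofReal (t / 2) * μ {ω | t / 2 ≤ |f ω|} := by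
    have : (4 : ℝ≥0∞) = ENNReal.ofReal 2 * 2 := by norm_num
    rw [this, mul_assoc, ← lintegral_const_mul' 2 _ (by norm_num)]
    congr 1
    refine setLIntegral_congr_fun measurableSet_Ioi fun t ht => ?_
    have hs : {ω | t ≤ 2 * |f ω|} = {ω | t / 2 ≤ |f ω|} := by
      ext ω; simp only [Set.mem_ofPred_eq]; constructor <;> intro h <;> linarith
    have ht2 : ENNReal.ofReal (t ^ ((2 : ℝ) - 1)) = 2 * ENNReal.ofReal (t / 2) := by
      rw [show (2 : ℝ) - 1 = 1 by norm_num, Real.rpow_one,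
        show (2 : ℝ≥0∞) = ENNReal.ofReal 2 by norm_num, ← ENNReal.ofReal_mul (by norm_num)]
      congr 1; ring
    simp only [hs, ht2]
    ring
  rw [h1, h2] at h
  exact ((ENNReal.mul_right_inj (by norm_num) (by norm_num)).1 h).symm

lemma measurable_posteriorMean (P : Measure (EuclideanSpace ℝ (Fin d))) [IsFiniteMeasure P]
    (κ : Kernel (EuclideanSpace ℝ (Fin d)) 𝒴) [IsFiniteKernel κ] (i : Fin d) :
    Measurable fun y => ∫ x, x i ∂(posterior κ P y) := by
  have h : StronglyMeasurable fun x : EuclideanSpace ℝ (Fin d) => x i := by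
    refine Measurable.stronglyMeasurable ?_
    fun_prop
  exact (h.integral_kernel (κ := posterior κ P)).measurable

lemma natCast_two_sub_one : ((2 : ℕ) : ℝ≥0∞) - 1 = 1 := by
  rw [show ((2 : ℕ) : ℝ≥0∞) = 1 + 1 by norm_num]
  exact ENNReal.add_sub_cancel_right ENNReal.one_ne_top

/-- The Ziv-Zakai inequality: deciding by the posterior mean bounds `h(t, i, 2)` by the probability
that the posterior mean of `X_i` is off by at least `t / 2`. -/
theorem ZZ_two_le_mmse (P : Measure (EuclideanSpace ℝ (Fin d))) [IsFiniteMeasure P]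
    (κ : Kernel (EuclideanSpace ℝ (Fin d)) 𝒴) [IsFiniteKernel κ] : ZZ P κ 2 ≤ mmse P κ := by
  unfold ZZ mmse
  refine Finset.sum_le_sum fun i _ => ?_
  have hm := measurable_posteriorMean P κ i
  rw [← lintegral_half_mul_meas_le (P ⊗ₘ κ)
    (f := fun z => z.1 i - ∫ x, x i ∂(posterior κ P z.2))
      (Measurable.sub (by fun_prop) (hm.comp measurable_snd))]
  refine setLIntegral_mono' measurableSet_Ioi fun t ht => mul_le_mul_right ?_ _
  rw [natCast_two_sub_one, div_one]
  exact iSup₂_le fun u hu => lintegral_minErrorProb_two_le P κ hm i ht u hu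

/-! ### Optimality of the posterior mean -/

/-- The mean minimizes the mean squared error among constants. If the right-hand side is finite
then `f` is square integrable, so the Bochner integral on the left is a genuine mean. -/
lemma lintegral_sq_sub_mean_le {Ω : Type*} [MeasurableSpace Ω] (μ : Measure Ω)
    [IsProbabilityMeasure μ] {f : Ω → ℝ} (hf : Measurable f) (c : ℝ) :
    ∫⁻ x, ENNReal.ofReal ((f x - ∫ y, f y ∂μ) ^ 2) ∂μ
      ≤ ∫⁻ x, ENNReal.ofReal ((f x - c) ^ 2) ∂μ := by
  by_cases h : ∫⁻ x, ENNReal.ofReal ((f x - c) ^ 2) ∂μ = ∞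
  · rw [h]; exact le_top
  have hsq : Integrable (fun x => (f x - c) ^ 2) μ :=
    ⟨by fun_prop, by
      rw [hasFiniteIntegral_iff_ofReal (ae_of_all _ fun x => sq_nonneg _)]
      exact lt_top_iff_ne_top.2 h⟩
  have hL2 : MemLp (fun x => f x - c) 2 μ := (memLp_two_iff_integrable_sq (by fun_prop)).2 hsq
  have hf2 : MemLp f 2 μ := by
    have := hL2.add (memLp_const c)
    refine this.ae_eq (ae_of_all _ fun x => ?_)
    simp
  have hI : Integrable f μ := hf2.integrable (by norm_num)
  have hsq' : Integrable (fun x => (f x - ∫ y, f y ∂μ) ^ 2) μ :=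
    (hf2.sub (memLp_const _)).integrable_sq
  rw [← ofReal_integral_eq_lintegral_ofReal hsq' (ae_of_all _ fun x => sq_nonneg _),
    ← ofReal_integral_eq_lintegral_ofReal hsq (ae_of_all _ fun x => sq_nonneg _)]
  refine ENNReal.ofReal_le_ofReal ?_
  set a := ∫ y, f y ∂μ with ha
  have hexp : ∀ x, (f x - c) ^ 2 = (f x - a) ^ 2 + (2 * (a - c) * (f x - a) + (a - c) ^ 2) :=
    fun x => by ring
  have hIa : Integrable (fun x => f x - a) μ := hI.sub (integrable_const a)
  have hIb : Integrable (fun x => 2 * (a - c) * (f x - a)) μ := hIa.const_mul _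
  simp_rw [hexp]
  rw [integral_add hsq' (g := fun x => 2 * (a - c) * (f x - a) + (a - c) ^ 2)
      (hIb.add (integrable_const _)), integral_add hIb (integrable_const _), integral_const_mul,
    integral_sub hI (integrable_const a)]
  simp [← ha, sq_nonneg]

/-- The posterior mean has the least mean squared error among all estimators `g`. -/
theorem lintegral_sq_sub_posteriorMean_le (P : Measure (EuclideanSpace ℝ (Fin d)))
    [IsFiniteMeasure P] (κ : Kernel (EuclideanSpace ℝ (Fin d)) 𝒴) [IsFiniteKernel κ] (i : Fin d)
    {g : 𝒴 → ℝ} (hg : Measurable g) :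
    ∫⁻ z, ENNReal.ofReal ((z.1 i - ∫ x, x i ∂(posterior κ P z.2)) ^ 2) ∂(P ⊗ₘ κ)
      ≤ ∫⁻ z, ENNReal.ofReal ((z.1 i - g z.2) ^ 2) ∂(P ⊗ₘ κ) := by
  have hdis : ∀ h : 𝒴 → ℝ, Measurable h →
      ∫⁻ z, ENNReal.ofReal ((z.1 i - h z.2) ^ 2) ∂(P ⊗ₘ κ)
        = ∫⁻ y, ∫⁻ x, ENNReal.ofReal ((x i - h y) ^ 2) ∂(posterior κ P y) ∂(κ ∘ₘ P) := by
    intro h hh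
    rw [← Measure.lintegral_compProd
        (f := fun z : 𝒴 × EuclideanSpace ℝ (Fin d) => ENNReal.ofReal ((z.2 i - h z.1) ^ 2))
        (by fun_prop),
      compProd_posterior_eq_map_swap, lintegral_map (by fun_prop) measurable_swap]
    rfl
  rw [hdis _ (measurable_posteriorMean P κ i), hdis g hg]
  refine lintegral_mono fun y => ?_
  exact lintegral_sq_sub_mean_le (posterior κ P y) (f := fun x => x i) (by fun_prop) (g y)

end

/-! ### The additive Gaussian channel -/

section
open scoped MatrixOrder

lemma awgn_apply (d : ℕ) {η : ℝ} (hη : 0 ≤ η) (x : EuclideanSpace ℝ (Fin d)) :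
    awgn d η x = (stdGaussian (EuclideanSpace ℝ (Fin d))).map (fun z => x + √η • z) := by
  have hsqrt : CFC.sqrt (η • (1 : Matrix (Fin d) (Fin d) ℝ)) = √η • 1 := by
    refine CFC.sqrt_unique ?_ ?_
    · rw [smul_mul_smul_comm, Real.mul_self_sqrt hη, mul_one]
    · exact (Matrix.PosSemidef.one.smul (Real.sqrt_nonneg η)).nonneg
  change (multivariateGaussian 0 (η • (1 : Matrix (Fin d) (Fin d) ℝ))).map (fun n => x + n) = _
  rw [multivariateGaussian, hsqrt, Measure.map_map (by fun_prop) (by fun_prop)]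
  congr 1
  ext z
  simp

end

/-- Expectations over the input and output of the Gaussian channel, written with `Y = X + √η Z` for
`Z` standard Gaussian and independent of `X`. -/
lemma lintegral_compProd_awgn {d : ℕ} (P : Measure (EuclideanSpace ℝ (Fin d))) [SFinite P]
    {η : ℝ} (hη : 0 ≤ η)
    {f : EuclideanSpace ℝ (Fin d) × EuclideanSpace ℝ (Fin d) → ℝ≥0∞} (hf : Measurable f) :
    ∫⁻ z, f z ∂(P ⊗ₘ awgn d η)
      = ∫⁻ w, f (w.1, w.1 + √η • w.2) ∂(P.prod (stdGaussian (EuclideanSpace ℝ (Fin d)))) := by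
  rw [Measure.lintegral_compProd hf, lintegral_prod _ (by fun_prop)]
  refine lintegral_congr fun x => ?_
  rw [awgn_apply d hη, lintegral_map (by fun_prop) (by fun_prop)]

lemma map_eval_stdGaussian {d : ℕ} (i : Fin d) :
    (stdGaussian (EuclideanSpace ℝ (Fin d))).map (fun z => z i) = gaussianReal 0 1 := by
  have h := (measurePreserving_eval_multivariateGaussian (μ := 0) (i := i)
    (Matrix.PosSemidef.one (n := Fin d) (R := ℝ))).map_eq
  simpa using h

lemma lintegral_sq_eval_stdGaussian {d : ℕ} (i : Fin d) :
    ∫⁻ z, ENNReal.ofReal (z i ^ 2) ∂(stdGaussian (EuclideanSpace ℝ (Fin d))) = 1 := by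
  rw [← lintegral_map (μ := stdGaussian (EuclideanSpace ℝ (Fin d)))
    (f := fun x : ℝ => ENNReal.ofReal (x ^ 2)) (g := fun z => z i) (by fun_prop) (by fun_prop),
    map_eval_stdGaussian]
  have hint : Integrable (fun x : ℝ => x ^ 2) (gaussianReal 0 1) :=
    (memLp_id_gaussianReal 2).integrable_sq
  rw [← ofReal_integral_eq_lintegral_ofReal hint (ae_of_all _ fun x => sq_nonneg _)]
  have hv := variance_fun_id_gaussianReal (μ := 0) (v := 1)
  rw [variance_of_integral_eq_zero (by fun_prop) (by simp)] at hv
  simp [hv]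

/-! ### The mmse is at most of order `α d η` -/

/-- The estimator that outputs `y`, corrected to the atom `a ∈ F` if `a` is within `r` of `y`.
It is only meant for `r` so small that at most one atom of `F` is that close. -/
noncomputable def snapEstimator {d : ℕ} (F : Finset (EuclideanSpace ℝ (Fin d))) (r : ℝ)
    (y : EuclideanSpace ℝ (Fin d)) : EuclideanSpace ℝ (Fin d) :=
  y + ∑ a ∈ F, (Metric.closedBall a r).indicator (fun y => a - y) y

lemma measurable_snapEstimator {d : ℕ} (F : Finset (EuclideanSpace ℝ (Fin d))) (r : ℝ) :
    Measurable (snapEstimator F r) := by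
  unfold snapEstimator
  refine measurable_id.add (Finset.measurable_fun_sum _ fun a _ => ?_)
  exact Measurable.indicator (by fun_prop) Metric.isClosed_closedBall.measurableSet

lemma norm_snapEstimator_sub_le {d : ℕ} (F : Finset (EuclideanSpace ℝ (Fin d))) {r : ℝ}
    (hr : 0 ≤ r) (y : EuclideanSpace ℝ (Fin d)) : ‖snapEstimator F r y - y‖ ≤ F.card * r := by
  rw [snapEstimator, add_sub_cancel_left]
  refine (norm_sum_le_of_le (f := fun a => (Metric.closedBall a r).indicator (fun y => a - y) y)
    (n := fun _ => r) F fun a _ => ?_).trans (by simp)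
  by_cases h : y ∈ Metric.closedBall a r
  · rw [Set.indicator_of_mem h]
    rw [Metric.mem_closedBall, dist_comm, dist_eq_norm] at h
    exact h
  · rw [Set.indicator_of_notMem h]
    simpa using hr

/-- Observing `x + √η z` with small `η`, the estimator with radius `K √η` returns `x` if `x` is one
of the atoms and `‖z‖ ≤ K`, and the observation itself otherwise. -/
lemma eventually_snapEstimator_eq {d : ℕ} (F : Finset (EuclideanSpace ℝ (Fin d))) (K : ℝ)
    (x z : EuclideanSpace ℝ (Fin d)) [Decidable (x ∈ F ∧ ‖z‖ ≤ K)] :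
    ∀ᶠ η : ℝ in 𝓝[>] 0, snapEstimator F (K * √η) (x + √η • z)
      = if x ∈ F ∧ ‖z‖ ≤ K then x else x + √η • z := by
  have hfar : ∀ a ∈ F, a ≠ x → ∀ᶠ η : ℝ in 𝓝[>] 0,
      x + √η • z ∉ Metric.closedBall a (K * √η) := by
    intro a _ hax
    have h1 : Tendsto (fun η : ℝ => dist (x + √η • z) a) (𝓝[>] 0) (𝓝 (dist (x + √0 • z) a)) :=
      (Continuous.tendsto (by fun_prop) 0).mono_left nhdsWithin_le_nhds
    have h2 : Tendsto (fun η : ℝ => K * √η) (𝓝[>] 0) (𝓝 (K * √0)) :=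
      (Continuous.tendsto (by fun_prop) 0).mono_left nhdsWithin_le_nhds
    have hlt : K * √0 < dist (x + √0 • z) a := by
      simpa using Ne.symm hax
    filter_upwards [h2.eventually_lt h1 hlt] with η h
    simpa [Metric.mem_closedBall] using h
  have hall : ∀ᶠ η : ℝ in 𝓝[>] 0, ∀ a ∈ F, a ≠ x →
      x + √η • z ∉ Metric.closedBall a (K * √η) := by
    rw [Filter.eventually_all_finset]
    intro a ha
    by_cases hax : a = x
    · exact Eventually.of_forall fun _ h => absurd hax h
    · filter_upwards [hfar a ha hax] with η h _ using h
  filter_upwards [hall, self_mem_nhdsWithin] with η hη hpos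
  have hs : 0 < √η := Real.sqrt_pos.2 hpos
  have hmem : x + √η • z ∈ Metric.closedBall x (K * √η) ↔ ‖z‖ ≤ K := by
    rw [Metric.mem_closedBall, dist_eq_norm, add_sub_cancel_left, norm_smul, Real.norm_eq_abs,
      abs_of_pos hs, mul_comm, mul_le_mul_iff_left₀ hs]
  rw [snapEstimator]
  by_cases hx : x ∈ F
  · rw [Finset.sum_eq_single_of_mem x hx
      fun a ha hax => Set.indicator_of_notMem (hη a ha hax) _]
    by_cases hz : ‖z‖ ≤ K
    · rw [Set.indicator_of_mem (hmem.2 hz), if_pos ⟨hx, hz⟩]; abel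
    · rw [Set.indicator_of_notMem (fun h => hz (hmem.1 h)), if_neg (fun h => hz h.2), add_zero]
  · rw [Finset.sum_eq_zero fun a ha => Set.indicator_of_notMem
      (hη a ha fun h => hx (h ▸ ha)) _, if_neg (fun h => hx h.1), add_zero]

/-- A bound on the normalized squared error that does not depend on `η`, for dominated
convergence. -/
lemma sq_sub_snapEstimator_le {d : ℕ} (F : Finset (EuclideanSpace ℝ (Fin d))) {K : ℝ}
    (hK : 0 ≤ K) {η : ℝ} (hη : 0 < η) (x z : EuclideanSpace ℝ (Fin d)) (i : Fin d) :
    (x i - snapEstimator F (K * √η) (x + √η • z) i) ^ 2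
      ≤ (2 * z i ^ 2 + 2 * (F.card * K) ^ 2) * η := by
  set y := x + √η • z with hy
  have h1 := (PiLp.norm_apply_le (snapEstimator F (K * √η) y - y) i).trans
    (norm_snapEstimator_sub_le F (by positivity) y)
  rw [PiLp.sub_apply, Real.norm_eq_abs] at h1
  have h2 := sq_le_sq' (abs_le.1 h1).1 (abs_le.1 h1).2
  have h3 : y i = x i + √η * z i := by simp [hy]
  have h4 : √η ^ 2 = η := Real.sq_sqrt hη.le
  generalize snapEstimator F (K * √η) y i = s at h2 ⊢
  have h5 : (x i - s) ^ 2 ≤ 2 * (√η * z i) ^ 2 + 2 * (s - y i) ^ 2 := by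
    rw [h3]
    nlinarith [sq_nonneg (√η * z i - (s - (x i + √η * z i)))]
  calc (x i - s) ^ 2 ≤ 2 * (√η * z i) ^ 2 + 2 * (F.card * (K * √η)) ^ 2 := by linarith
    _ = (2 * z i ^ 2 + 2 * (F.card * K) ^ 2) * √η ^ 2 := by ring
    _ = _ := by rw [h4]

/-- The normalized squared error of the estimator in coordinate `i` converges to the mean of `Z_i²`
over the event that `X` is not one of the atoms `F` or `‖Z‖ > K`. -/
lemma tendsto_lintegral_snapEstimator {d : ℕ} (P : Measure (EuclideanSpace ℝ (Fin d)))
    [IsProbabilityMeasure P] (F : Finset (EuclideanSpace ℝ (Fin d))) {K : ℝ} (hK : 0 ≤ K)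
    (i : Fin d) :
    Tendsto (fun η : ℝ => (∫⁻ z, ENNReal.ofReal ((z.1 i - snapEstimator F (K * √η) z.2 i) ^ 2)
        ∂(P ⊗ₘ awgn d η)) / ENNReal.ofReal η) (𝓝[>] 0)
      (𝓝 (∫⁻ w, {w | ¬ (w.1 ∈ F ∧ ‖w.2‖ ≤ K)}.indicator
        (fun w => ENNReal.ofReal (w.2 i ^ 2)) w
        ∂(P.prod (stdGaussian (EuclideanSpace ℝ (Fin d)))))) := by
  classical
  set γ := stdGaussian (EuclideanSpace ℝ (Fin d)) with hγ
  have hmeas : ∀ η : ℝ, Measurable fun w : EuclideanSpace ℝ (Fin d) × EuclideanSpace ℝ (Fin d) =>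
      ENNReal.ofReal ((w.1 i - snapEstimator F (K * √η) w.2 i) ^ 2) := fun η => by
    have := measurable_snapEstimator F (K * √η)
    fun_prop
  have hmeas' : ∀ η : ℝ, Measurable fun w : EuclideanSpace ℝ (Fin d) × EuclideanSpace ℝ (Fin d) =>
      ENNReal.ofReal ((w.1 i - snapEstimator F (K * √η) (w.1 + √η • w.2) i) ^ 2) := fun η => by
    have := measurable_snapEstimator F (K * √η)
    fun_prop
  have heq : (fun η : ℝ => ∫⁻ w, ENNReal.ofReal
        ((w.1 i - snapEstimator F (K * √η) (w.1 + √η • w.2) i) ^ 2) / ENNReal.ofReal η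
        ∂(P.prod γ)) =ᶠ[𝓝[>] 0]
      fun η : ℝ => (∫⁻ z, ENNReal.ofReal ((z.1 i - snapEstimator F (K * √η) z.2 i) ^ 2)
        ∂(P ⊗ₘ awgn d η)) / ENNReal.ofReal η := by
    filter_upwards [self_mem_nhdsWithin] with η hη
    have hη' : 0 < η := hη
    simp only [div_eq_mul_inv]
    rw [lintegral_compProd_awgn P hη'.le (hmeas η), lintegral_mul_const _ (hmeas' η)]
  refine Tendsto.congr' heq ?_
  refine tendsto_lintegral_filter_of_dominated_convergence
    (F := fun (η : ℝ) (w : EuclideanSpace ℝ (Fin d) × EuclideanSpace ℝ (Fin d)) => ENNReal.ofReal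
        ((w.1 i - snapEstimator F (K * √η) (w.1 + √η • w.2) i) ^ 2) / ENNReal.ofReal η)
    (f := fun w => {w : EuclideanSpace ℝ (Fin d) × EuclideanSpace ℝ (Fin d) |
      ¬ (w.1 ∈ F ∧ ‖w.2‖ ≤ K)}.indicator (fun w => ENNReal.ofReal (w.2 i ^ 2)) w)
    (fun w => ENNReal.ofReal (2 * w.2 i ^ 2 + 2 * (F.card * K) ^ 2)) ?_ ?_ ?_ ?_
  · exact Eventually.of_forall fun η => (hmeas' η).div_const _
  · filter_upwards [self_mem_nhdsWithin] with η hη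
    refine ae_of_all _ fun w => ?_
    have hη' : 0 < η := hη
    refine ENNReal.div_le_of_le_mul ?_
    rw [← ENNReal.ofReal_mul (by positivity)]
    exact ENNReal.ofReal_le_ofReal (sq_sub_snapEstimator_le F hK hη' w.1 w.2 i)
  · rw [lintegral_prod _ (by fun_prop)]
    simp only [lintegral_const, measure_univ, mul_one]
    have : ∀ z : EuclideanSpace ℝ (Fin d), ENNReal.ofReal (2 * z i ^ 2 + 2 * (F.card * K) ^ 2)
        = 2 * ENNReal.ofReal (z i ^ 2) + ENNReal.ofReal (2 * (F.card * K) ^ 2) := fun z => by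
      rw [ENNReal.ofReal_add (by positivity) (by positivity), ENNReal.ofReal_mul (by norm_num)]
      norm_num
    simp_rw [this]
    rw [lintegral_add_right _ measurable_const, lintegral_const_mul _ (by fun_prop),
      lintegral_sq_eval_stdGaussian, lintegral_const, measure_univ]
    finiteness
  · refine ae_of_all _ fun w => ?_
    refine tendsto_const_nhds.congr' ?_
    filter_upwards [eventually_snapEstimator_eq F K w.1 w.2, self_mem_nhdsWithin] with η h hη
    have hη' : 0 < η := hη
    rw [h]
    by_cases hc : w.1 ∈ F ∧ ‖w.2‖ ≤ K
    · rw [Set.indicator_of_notMem (by simpa using hc), if_pos hc]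
      simp
    · rw [Set.indicator_of_mem (by simpa using hc), if_neg hc]
      have : (w.1 i - (w.1 + √η • w.2) i) ^ 2 = η * w.2 i ^ 2 := by
        simp only [PiLp.add_apply, PiLp.smul_apply, smul_eq_mul]
        rw [← Real.sq_sqrt hη'.le]
        simp only [Real.sqrt_sq (Real.sqrt_nonneg η)]
        ring
      rw [this, ENNReal.ofReal_mul hη'.le, mul_comm, mul_div_assoc, ENNReal.div_self, mul_one]
      · simpa using hη'
      · simp

/-- The limit above splits into the mass outside `F` and a Gaussian tail. -/
lemma lintegral_indicator_atoms_le {d : ℕ} (P : Measure (EuclideanSpace ℝ (Fin d)))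
    [IsProbabilityMeasure P] (F : Finset (EuclideanSpace ℝ (Fin d))) (K : ℝ) (i : Fin d) :
    ∫⁻ w, {w | ¬ (w.1 ∈ F ∧ ‖w.2‖ ≤ K)}.indicator (fun w => ENNReal.ofReal (w.2 i ^ 2)) w
        ∂(P.prod (stdGaussian (EuclideanSpace ℝ (Fin d))))
      ≤ P (F : Set (EuclideanSpace ℝ (Fin d)))ᶜ +
        ∫⁻ z in {z | K < ‖z‖}, ENNReal.ofReal (z i ^ 2)
          ∂(stdGaussian (EuclideanSpace ℝ (Fin d))) := by
  have hF : MeasurableSet (F : Set (EuclideanSpace ℝ (Fin d)))ᶜ :=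
    F.finite_toSet.measurableSet.compl
  have hT : MeasurableSet {z : EuclideanSpace ℝ (Fin d) | K < ‖z‖} :=
    measurableSet_lt (by fun_prop) (by fun_prop)
  set T : EuclideanSpace ℝ (Fin d) → ℝ≥0∞ :=
    {z | K < ‖z‖}.indicator fun z => ENNReal.ofReal (z i ^ 2) with hTdef
  have hTm : Measurable T := Measurable.indicator (by fun_prop) hT
  set A : EuclideanSpace ℝ (Fin d) → ℝ≥0∞ :=
    (F : Set (EuclideanSpace ℝ (Fin d)))ᶜ.indicator 1 with hAdef
  have hAm : Measurable A := measurable_one.indicator hF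
  calc _ ≤ ∫⁻ w, (A w.1 * ENNReal.ofReal (w.2 i ^ 2) + T w.2)
          ∂(P.prod (stdGaussian (EuclideanSpace ℝ (Fin d)))) := by
        refine lintegral_mono fun w => ?_
        by_cases h1 : w.1 ∈ F
        · by_cases h2 : ‖w.2‖ ≤ K
          · rw [Set.indicator_of_notMem (by simpa using ⟨h1, h2⟩)]
            exact zero_le
          · have : T w.2 = ENNReal.ofReal (w.2 i ^ 2) :=
              Set.indicator_of_mem (s := {z | K < ‖z‖})
                (show w.2 ∈ {z | K < ‖z‖} from lt_of_not_ge h2) _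
            rw [this]
            exact (Set.indicator_le_self _ _ _).trans le_add_self
        · have : A w.1 = 1 := Set.indicator_of_mem
            (show w.1 ∈ (F : Set (EuclideanSpace ℝ (Fin d)))ᶜ by simpa using h1) _
          rw [this, one_mul]
          exact (Set.indicator_le_self _ _ _).trans le_self_add
    _ = _ := by
        rw [lintegral_prod _ (by fun_prop)]
        have : ∀ x, ∫⁻ z, (A x * ENNReal.ofReal (z i ^ 2) + T z)
            ∂(stdGaussian (EuclideanSpace ℝ (Fin d)))
            = A x + ∫⁻ z, T z ∂(stdGaussian (EuclideanSpace ℝ (Fin d))) := fun x => by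
          rw [lintegral_add_right _ hTm, lintegral_const_mul _ (by fun_prop),
            lintegral_sq_eval_stdGaussian, mul_one]
        simp_rw [this]
        rw [lintegral_add_right _ measurable_const, lintegral_const, measure_univ, mul_one,
          lintegral_indicator_one hF, lintegral_indicator hT]

/-- If `S` is countable then `P Sᶜ` bounds the normalized mmse per dimension in the low-noise limit:
estimators that snap to finitely many atoms, chosen to exhaust `S`, achieve this. -/
theorem limsup_mmse_awgn_le {d : ℕ} (P : Measure (EuclideanSpace ℝ (Fin d)))
    [IsProbabilityMeasure P] {S : Set (EuclideanSpace ℝ (Fin d))} (hS : S.Countable) :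
    limsup (fun η : ℝ => mmse P (awgn d η) / ENNReal.ofReal η) (𝓝[>] 0) ≤ d * P Sᶜ := by
  classical
  set γ := stdGaussian (EuclideanSpace ℝ (Fin d)) with hγ
  -- The point `0` is added only to have a nonempty set to enumerate.
  obtain ⟨a, ha⟩ := (hS.insert 0).exists_eq_range (Set.insert_nonempty 0 S)
  set F : ℕ → Finset (EuclideanSpace ℝ (Fin d)) := fun n => (Finset.range n).image a with hF
  have hstep : ∀ n : ℕ, limsup (fun η : ℝ => mmse P (awgn d η) / ENNReal.ofReal η) (𝓝[>] 0)
      ≤ ∑ i : Fin d, (P (F n : Set (EuclideanSpace ℝ (Fin d)))ᶜ +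
        ∫⁻ z in {z | (n : ℝ) < ‖z‖}, ENNReal.ofReal (z i ^ 2) ∂γ) := by
    intro n
    have hlim := tendsto_finsetSum Finset.univ fun (i : Fin d) _ =>
      tendsto_lintegral_snapEstimator P (F n) (Nat.cast_nonneg n) i
    refine le_trans ?_ (Finset.sum_le_sum fun i _ => lintegral_indicator_atoms_le P (F n) n i)
    rw [← hlim.limsup_eq]
    refine limsup_le_limsup (Eventually.of_forall fun η => ?_)
    simp only [mmse, div_eq_mul_inv, Finset.sum_mul]
    refine Finset.sum_le_sum fun i _ => mul_le_mul_left ?_ _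
    have hm := measurable_snapEstimator (F n) ((n : ℝ) * √η)
    exact lintegral_sq_sub_posteriorMean_le P (awgn d η) i
      (g := fun y => snapEstimator (F n) ((n : ℝ) * √η) y i) (by fun_prop)
  have hFlim : Tendsto (fun n => P (F n : Set (EuclideanSpace ℝ (Fin d)))ᶜ) atTop
      (𝓝 (P (insert 0 S)ᶜ)) := by
    have hInter : (insert 0 S)ᶜ = ⋂ n, (F n : Set (EuclideanSpace ℝ (Fin d)))ᶜ := by
      rw [ha, ← Set.compl_iUnion]
      congr 1
      ext x
      simp only [Set.mem_range, Set.mem_iUnion, hF, Finset.coe_image, Set.mem_image,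
        Finset.coe_range, Set.mem_Iio]
      exact ⟨fun ⟨k, hk⟩ => ⟨k + 1, k, k.lt_succ_self, hk⟩, fun ⟨_, k, _, hk⟩ => ⟨k, hk⟩⟩
    rw [hInter]
    refine tendsto_measure_iInter_atTop
      (fun n => (F n).finite_toSet.measurableSet.compl.nullMeasurableSet) ?_
      ⟨0, measure_ne_top _ _⟩
    intro m n hmn
    refine Set.compl_subset_compl.2 (Finset.coe_subset.2 ?_)
    exact Finset.image_subset_image (Finset.range_subset_range.2 hmn)
  have hTail : ∀ i : Fin d, Tendsto (fun n : ℕ =>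
      ∫⁻ z in {z | (n : ℝ) < ‖z‖}, ENNReal.ofReal (z i ^ 2) ∂γ) atTop (𝓝 0) := by
    intro i
    have hm : ∀ n : ℕ, MeasurableSet {z : EuclideanSpace ℝ (Fin d) | (n : ℝ) < ‖z‖} := fun n =>
      measurableSet_lt (by fun_prop) (by fun_prop)
    simp_rw [← lintegral_indicator (hm _)]
    rw [← lintegral_zero (μ := γ)]
    refine tendsto_lintegral_of_dominated_convergence (fun z => ENNReal.ofReal (z i ^ 2))
      (fun n => Measurable.indicator (by fun_prop) (hm n))
      (fun n => ae_of_all _ fun z => Set.indicator_le_self _ _ _) ?_ ?_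
    · rw [lintegral_sq_eval_stdGaussian]; exact ENNReal.one_ne_top
    · refine ae_of_all _ fun z => tendsto_const_nhds.congr' ?_
      filter_upwards [tendsto_natCast_atTop_atTop.eventually_ge_atTop ‖z‖] with n hn
      rw [Set.indicator_of_notMem]
      simpa using hn
  have hsum := tendsto_finsetSum Finset.univ fun (i : Fin d) _ => hFlim.add (hTail i)
  refine (ge_of_tendsto' hsum hstep).trans ?_
  simp only [add_zero, Finset.sum_const, Finset.card_univ, Fintype.card_fin, nsmul_eq_mul]
  exact mul_le_mul_right (measure_mono (Set.compl_subset_compl.2 (Set.subset_insert 0 S))) _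

/-! ### Testing between two shifts of a Gaussian -/

/-- Reweighting one factor of a product measure. -/
lemma pi_withDensity_eval {ι : Type*} [Fintype ι] [DecidableEq ι] {X : ι → Type*}
    [∀ i, MeasurableSpace (X i)] (μ : ∀ i, Measure (X i)) [∀ i, IsProbabilityMeasure (μ i)]
    (ν : ∀ i, Measure (X i)) [∀ i, SigmaFinite (ν i)] (i : ι) {r : X i → ℝ≥0∞} (hr : Measurable r)
    (hi : ν i = (μ i).withDensity r) (hne : ∀ j, j ≠ i → ν j = μ j) :
    Measure.pi ν = (Measure.pi μ).withDensity fun x => r (x i) := by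
  refine Measure.pi_eq fun s hs => ?_
  rw [withDensity_apply _ (MeasurableSet.univ_pi hs), Measure.restrict_pi_pi,
    ← lintegral_map (f := r) (g := fun x : ∀ i, X i => x i) hr (by fun_prop)]
  have h := Measure.pi_map_eval (μ := fun j => (μ j).restrict (s j)) i
  rw [show (fun x : ∀ i, X i => x i) = Function.eval i from rfl, h, lintegral_smul_measure,
    ← withDensity_apply _ (hs i), ← hi, smul_eq_mul, mul_comm,
    ← Finset.mul_prod_erase _ _ (Finset.mem_univ i)]
  congr 1
  refine Finset.prod_congr rfl fun j hj => ?_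
  rw [Measure.restrict_apply_univ, hne j (Finset.ne_of_mem_erase hj)]

lemma gaussianReal_eq_withDensity_exp (s : ℝ) :
    gaussianReal s 1
      = (gaussianReal 0 1).withDensity fun x => ENNReal.ofReal (Real.exp (s * x - s ^ 2 / 2)) := by
  rw [gaussianReal_of_var_ne_zero _ one_ne_zero, gaussianReal_of_var_ne_zero _ one_ne_zero,
    ← withDensity_mul _ (measurable_gaussianPDF 0 1) (by fun_prop)]
  congr 1
  ext x
  simp only [gaussianPDF, Pi.mul_apply, gaussianPDFReal]
  rw [← ENNReal.ofReal_mul (by positivity), mul_assoc _ (Real.exp _), ← Real.exp_add]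
  congr 3
  simp
  ring

/-- The Cameron-Martin formula for a shift along a coordinate axis. -/
lemma map_add_single_stdGaussian {d : ℕ} (i : Fin d) (s : ℝ) :
    (stdGaussian (EuclideanSpace ℝ (Fin d))).map (fun z => z + EuclideanSpace.single i s)
      = (stdGaussian (EuclideanSpace ℝ (Fin d))).withDensity
          fun z => ENNReal.ofReal (Real.exp (s * z i - s ^ 2 / 2)) := by
  have hshift : (Measure.pi fun _ : Fin d => gaussianReal 0 1).map
        (fun x j => x j + if j = i then s else 0)
      = (Measure.pi fun _ : Fin d => gaussianReal 0 1).withDensity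
          fun x => ENNReal.ofReal (Real.exp (s * x i - s ^ 2 / 2)) := by
    rw [Measure.pi_map_pi (μ := fun _ : Fin d => gaussianReal 0 1)
      (f := fun j x => x + if j = i then s else 0) (by fun_prop)]
    refine pi_withDensity_eval (fun _ : Fin d => gaussianReal 0 1) _ i
      (r := fun x => ENNReal.ofReal (Real.exp (s * x - s ^ 2 / 2))) (by fun_prop) ?_ ?_
    · simp [gaussianReal_map_add_const, gaussianReal_eq_withDensity_exp s]
    · intro j hj
      simp [hj]
  rw [← map_pi_eq_stdGaussian, Measure.map_map (by fun_prop) (by fun_prop)]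
  have hcomp : (fun z : EuclideanSpace ℝ (Fin d) => z + EuclideanSpace.single i s) ∘ WithLp.toLp 2
      = WithLp.toLp 2 ∘ fun (x : Fin d → ℝ) j => x j + if j = i then s else 0 := by
    ext x j
    simp
  rw [hcomp, ← Measure.map_map (by fun_prop) (by fun_prop), hshift]
  ext A hA
  rw [withDensity_apply _ hA, Measure.map_apply (by fun_prop) hA,
    withDensity_apply _ (hA.preimage (by fun_prop)), setLIntegral_map hA (by fun_prop) (by fun_prop)]

/-- The Neyman-Pearson bound for a standard Gaussian against its shift by `s` in coordinate `i`:
the sum of the two error probabilities is least for the likelihood ratio test `z_i < s / 2`. -/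
lemma stdGaussian_error_ge {d : ℕ} (i : Fin d) {s : ℝ} (hs : 0 < s)
    {B : Set (EuclideanSpace ℝ (Fin d))} (hB : MeasurableSet B) :
    stdGaussian (EuclideanSpace ℝ (Fin d)) {z | s < 2 * |z i|}
      ≤ stdGaussian (EuclideanSpace ℝ (Fin d)) B
        + stdGaussian (EuclideanSpace ℝ (Fin d)) {z | z + EuclideanSpace.single i s ∉ B} := by
  set γ := stdGaussian (EuclideanSpace ℝ (Fin d)) with hγ
  set δ := γ.map fun z => z + EuclideanSpace.single i s with hδ
  set H : Set (EuclideanSpace ℝ (Fin d)) := {z | z i < s / 2} with hHdef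
  have hH : MeasurableSet H := measurableSet_lt (by fun_prop) (by fun_prop)
  have hle : ∀ A, MeasurableSet A → A ⊆ H → δ A ≤ γ A := by
    intro A hA hAH
    rw [hδ, map_add_single_stdGaussian, withDensity_apply _ hA, ← setLIntegral_one]
    refine setLIntegral_mono' hA fun z hz => ?_
    rw [← ENNReal.ofReal_one]
    refine ENNReal.ofReal_le_ofReal (Real.exp_le_one_iff.2 ?_)
    have : z i < s / 2 := hAH hz
    nlinarith
  have hge : ∀ A, MeasurableSet A → A ⊆ Hᶜ → γ A ≤ δ A := by
    intro A hA hAH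
    rw [hδ, map_add_single_stdGaussian, withDensity_apply _ hA, ← setLIntegral_one]
    refine setLIntegral_mono' hA fun z hz => ?_
    rw [← ENNReal.ofReal_one]
    refine ENNReal.ofReal_le_ofReal (Real.one_le_exp ?_)
    have : s / 2 ≤ z i := not_lt.1 (hAH hz)
    nlinarith
  have hδB : γ {z | z + EuclideanSpace.single i s ∉ B} = δ Bᶜ := by
    rw [hδ, Measure.map_apply (by fun_prop) hB.compl]; rfl
  have hδH : δ H = γ {z | z i < -(s / 2)} := by
    rw [hδ, Measure.map_apply (by fun_prop) hH]
    congr 1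
    ext z
    simp only [hHdef, Set.mem_preimage, Set.mem_ofPred_eq, PiLp.add_apply]
    simp only [PiLp.single_apply, if_true]
    constructor <;> intro h <;> linarith
  calc γ {z | s < 2 * |z i|} ≤ γ (Hᶜ ∪ {z | z i < -(s / 2)}) := by
        refine measure_mono fun z hz => ?_
        simp only [Set.mem_ofPred_eq] at hz
        rcases le_or_gt 0 (z i) with h | h
        · rw [abs_of_nonneg h] at hz
          exact Or.inl fun hlt : z i < s / 2 => by linarith
        · rw [abs_of_neg h] at hz
          exact Or.inr (show z i < -(s / 2) by linarith)
    _ ≤ γ Hᶜ + δ H := by rw [hδH]; exact measure_union_le _ _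
    _ = (γ (Hᶜ ∩ B) + γ (Hᶜ \ B)) + (δ (H ∩ B) + δ (H \ B)) := by
        rw [measure_inter_add_sdiff _ hB, measure_inter_add_sdiff _ hB]
    _ ≤ (γ (Hᶜ ∩ B) + δ (Hᶜ \ B)) + (γ (H ∩ B) + δ (H \ B)) := by
        refine add_le_add (add_le_add le_rfl ?_) (add_le_add ?_ le_rfl)
        · exact hge _ (hH.compl.diff hB) Set.sdiff_subset
        · exact hle _ (hH.inter hB) Set.inter_subset_left
    _ = (γ (B ∩ H) + γ (B \ H)) + (δ (Bᶜ ∩ H) + δ (Bᶜ \ H)) := by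
        rw [Set.inter_comm B H, Set.sdiff_eq B H, Set.inter_comm B Hᶜ, Set.sdiff_eq H B,
          Set.sdiff_eq Hᶜ B, Set.sdiff_eq Bᶜ H, Set.inter_comm Bᶜ H, Set.inter_comm Bᶜ Hᶜ]
        ring
    _ = _ := by rw [measure_inter_add_sdiff _ hH, measure_inter_add_sdiff _ hH, hδB]

/-- The two hypotheses `u_0 = 0` and `u_1 = t e_i`. -/
noncomputable def axisPair {d : ℕ} (i : Fin d) (t : ℝ) (k : Fin 2) : EuclideanSpace ℝ (Fin d) :=
  EuclideanSpace.single i (((k : ℕ) : ℝ) * t)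

/-- Rescaling by `√η` reduces the Gaussian channel to the Neyman-Pearson bound for a unit-variance
shift by `t / √η`. -/
lemma minErrorProb_awgn_ge {d : ℕ} {η : ℝ} (hη : 0 < η) (x : EuclideanSpace ℝ (Fin d))
    (p : Fin 2 → ℝ≥0∞) (i : Fin d) {t : ℝ} (ht : 0 < t) :
    min (p 0) (p 1) * stdGaussian (EuclideanSpace ℝ (Fin d)) {z | t < 2 * √η * |z i|}
      ≤ minErrorProb (awgn d η) x p (axisPair i t) := by
  have hs : 0 < √η := Real.sqrt_pos.2 hη
  refine le_iInf₂ fun φ hφ => ?_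
  rw [Fin.sum_univ_two]
  have hφ0 : MeasurableSet {y | φ y ≠ 0} := hφ (MeasurableSet.of_discrete (s := {k | k ≠ 0}))
  have hφ1 : MeasurableSet {y | φ y ≠ 1} := hφ (MeasurableSet.of_discrete (s := {k | k ≠ 1}))
  have hnp := stdGaussian_error_ge i (div_pos ht hs)
    (B := (fun z => x + √η • z) ⁻¹' {y | φ y ≠ 0}) (hφ0.preimage (by fun_prop))
  have hset : {z : EuclideanSpace ℝ (Fin d) | t < 2 * √η * |z i|} = {z | t / √η < 2 * |z i|} := by
    ext z
    simp only [Set.mem_ofPred_eq]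
    rw [div_lt_iff₀ hs, show 2 * |z i| * √η = 2 * √η * |z i| by ring]
  have h0 : awgn d η (x + axisPair i t 0) {y | φ y ≠ 0}
      = stdGaussian (EuclideanSpace ℝ (Fin d)) ((fun z => x + √η • z) ⁻¹' {y | φ y ≠ 0}) := by
    rw [awgn_apply d hη.le, Measure.map_apply (by fun_prop) hφ0]
    have : axisPair i t 0 = 0 := by ext j; simp [axisPair]
    rw [this, add_zero]
  have h1 : awgn d η (x + axisPair i t 1) {y | φ y ≠ 1}
      = stdGaussian (EuclideanSpace ℝ (Fin d)) {z | z + EuclideanSpace.single i (t / √η) ∉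
        (fun z => x + √η • z) ⁻¹' {y | φ y ≠ 0}} := by
    rw [awgn_apply d hη.le, Measure.map_apply (by fun_prop) hφ1]
    congr 1
    ext z
    have : √η • (z + EuclideanSpace.single i (t / √η)) = axisPair i t 1 + √η • z := by
      ext j
      by_cases hj : j = i
      · subst hj
        simp [axisPair]
        field_simp
        ring
      · simp [axisPair, hj]
    simp only [Set.mem_preimage, Set.mem_ofPred_eq, this, add_assoc]
    generalize φ _ = k
    fin_cases k <;> simp
  rw [h0, h1, hset]
  calc _ ≤ min (p 0) (p 1) * (_ + _) := mul_le_mul_right hnp _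
    _ = _ := mul_add _ _ _
    _ ≤ _ := add_le_add (mul_le_mul_left (min_le_left _ _) _) (mul_le_mul_left (min_le_right _ _) _)

/-- A measure dominated by both shifted laws has at most the mass of the smaller prior weight. -/
lemma measure_univ_le_lintegral_min_priorU {d : ℕ} (P : Measure (EuclideanSpace ℝ (Fin d)))
    [IsFiniteMeasure P] (u : Fin 2 → EuclideanSpace ℝ (Fin d))
    {m : Measure (EuclideanSpace ℝ (Fin d))} (hm : ∀ k, m ≤ shiftLaw P (u k)) :
    m Set.univ ≤ ∫⁻ x, min (priorU P u x 0) (priorU P u x 1) ∂(muU P u) := by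
  have hmeas : ∀ k, Measurable fun x => priorU P u x k := fun k =>
    Measure.measurable_rnDeriv (shiftLaw P (u k)) (muU P u)
  have hset : ∀ k s, MeasurableSet s → m s ≤ ∫⁻ x in s, priorU P u x k ∂(muU P u) := by
    intro k s hs
    have : ∫⁻ x in s, priorU P u x k ∂(muU P u) = shiftLaw P (u k) s :=
      Measure.setLIntegral_rnDeriv (Measure.absolutelyContinuous_of_le (shiftLaw_le_muU P u k)) s
    rw [this]
    exact hm k s
  set B := {x | priorU P u x 0 ≤ priorU P u x 1} with hBdef
  have hB : MeasurableSet B := measurableSet_le (hmeas 0) (hmeas 1)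
  rw [← measure_add_measure_compl hB, ← lintegral_add_compl _ hB]
  refine add_le_add ((hset 0 B hB).trans (setLIntegral_mono' hB fun x hx => ?_))
    ((hset 1 Bᶜ hB.compl).trans (setLIntegral_mono' hB.compl fun x hx => ?_))
  · exact le_min le_rfl hx
  · exact le_min (le_of_not_ge hx) le_rfl

/-! ### Overlap of an absolutely continuous law with its small translates -/

/-- The mass that the density of `Q` shares with its translate by `v`. -/
noncomputable def overlap {d : ℕ} (Q : Measure (EuclideanSpace ℝ (Fin d)))
    (v : EuclideanSpace ℝ (Fin d)) : ℝ≥0∞ :=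
  ∫⁻ x, min (Q.rnDeriv volume x) (Q.rnDeriv volume (x + v))

lemma shiftLaw_eq_withDensity {d : ℕ} (Q : Measure (EuclideanSpace ℝ (Fin d)))
    [IsFiniteMeasure Q] (hQ : Q ≪ volume) (v : EuclideanSpace ℝ (Fin d)) :
    shiftLaw Q v = volume.withDensity fun x => Q.rnDeriv volume (x + v) := by
  have hf := Measure.measurable_rnDeriv Q volume
  ext s hs
  rw [shiftLaw, Measure.map_apply (by fun_prop) hs, withDensity_apply _ hs]
  conv_lhs => rw [← Measure.withDensity_rnDeriv_eq Q volume hQ]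
  have hs' : MeasurableSet ((fun x => x - v) ⁻¹' s) := hs.preimage (by fun_prop)
  rw [withDensity_apply _ hs', ← lintegral_indicator hs', ← lintegral_indicator hs,
    ← lintegral_add_right_eq_self _ v]
  refine lintegral_congr fun x => ?_
  by_cases hx : x ∈ s
  · rw [Set.indicator_of_mem hx, Set.indicator_of_mem (by simpa using hx)]
  · rw [Set.indicator_of_notMem hx, Set.indicator_of_notMem (by simpa using hx)]

/-- Translation is continuous in `L¹`, so a law with a density overlaps almost entirely with its
small translates. -/
lemma eventually_le_overlap {d : ℕ} (Q : Measure (EuclideanSpace ℝ (Fin d)))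
    [IsProbabilityMeasure Q] (hQ : Q ≪ volume) {c : ℝ≥0∞} (hc : c < 1) :
    ∀ᶠ v in 𝓝 (0 : EuclideanSpace ℝ (Fin d)), c ≤ overlap Q v := by
  set f := Q.rnDeriv volume with hfdef
  have hf : Measurable f := Measure.measurable_rnDeriv Q volume
  have hf1 : ∫⁻ x, f x = 1 := by
    rw [hfdef, Measure.lintegral_rnDeriv hQ, measure_univ]
  have hint : MemLp (fun x => (f x).toReal) 1 volume :=
    memLp_one_iff_integrable.2 (integrable_toReal_of_lintegral_ne_top hf.aemeasurable (by simp [hf1]))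
  have hmp : ∀ v : EuclideanSpace ℝ (Fin d),
      MeasurePreserving (fun x => x + v) (volume : Measure (EuclideanSpace ℝ (Fin d))) volume :=
    fun v => measurePreserving_add_right volume v
  set g : C(EuclideanSpace ℝ (Fin d), C(EuclideanSpace ℝ (Fin d), EuclideanSpace ℝ (Fin d))) :=
    (ContinuousMap.mk (fun p : EuclideanSpace ℝ (Fin d) × EuclideanSpace ℝ (Fin d) => p.2 + p.1)
      (by fun_prop)).curry with hgdef
  have hg : ∀ v, MeasurePreserving (g v) volume volume := hmp
  have hlim := Filter.Tendsto.compMeasurePreservingLp (l := 𝓝 (0 : EuclideanSpace ℝ (Fin d)))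
    (f := fun _ => hint.toLp) (f₀ := hint.toLp) tendsto_const_nhds
    (g.continuous.tendsto 0) hg (hg 0) ENNReal.one_ne_top
  have hed : Tendsto (fun v => ∫⁻ x, ‖(f (x + v)).toReal - (f x).toReal‖ₑ)
      (𝓝 (0 : EuclideanSpace ℝ (Fin d))) (𝓝 0) := by
    have h := (tendsto_iff_edist_tendsto_0).1 hlim
    refine h.congr fun v => ?_
    rw [Lp.toLp_compMeasurePreserving, Lp.toLp_compMeasurePreserving, Lp.edist_toLp_toLp,
      eLpNorm_one_eq_lintegral_enorm]
    refine lintegral_congr fun x => ?_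
    simp [g]
  -- `a ≤ min a b + |a - b|`, integrated.
  have hsum : ∀ v, 1 ≤ overlap Q v + ∫⁻ x, ‖(f (x + v)).toReal - (f x).toReal‖ₑ := by
    intro v
    have hfin := Measure.rnDeriv_lt_top Q volume
    have hfin' : ∀ᵐ x, f (x + v) < ∞ := (hmp v).quasiMeasurePreserving.ae hfin
    rw [overlap, ← lintegral_add_left (by fun_prop), ← hf1]
    refine lintegral_mono_ae ?_
    filter_upwards [hfin, hfin'] with x h1 h2
    rcases le_total (f x) (f (x + v)) with h | h
    · rw [min_eq_left h]; exact le_self_add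
    · rw [min_eq_right h, ← enorm_neg, neg_sub, Real.enorm_of_nonneg
        (sub_nonneg.2 (ENNReal.toReal_mono h1.ne h)), ENNReal.ofReal_sub _ ENNReal.toReal_nonneg,
        ENNReal.ofReal_toReal h1.ne, ENNReal.ofReal_toReal h2.ne, add_tsub_cancel_of_le h]
  filter_upwards [hed.eventually_lt_const (tsub_pos_of_lt hc)] with v hv
  have h1 := hsum v
  by_contra hlt
  have h2 := ENNReal.add_lt_add (not_le.1 hlt) hv
  rw [add_tsub_cancel_of_le hc.le] at h2
  exact absurd h1 (not_le.2 h2)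

/-! ### The Ziv-Zakai bound is at least of order `α d η` -/

/-- Testing `u_0 = 0` against `u_1 = t e_i`, only the overlap of the absolutely continuous part
being taken into account. -/
lemma hZZ_awgn_ge {d : ℕ} {a : ℝ≥0∞} (P Q : Measure (EuclideanSpace ℝ (Fin d)))
    [IsFiniteMeasure P] [IsFiniteMeasure Q] (hQ : Q ≪ volume) (hPQ : a • Q ≤ P) {η : ℝ}
    (hη : 0 < η) (i : Fin d) {t : ℝ} (ht : 0 < t) :
    a * overlap Q (EuclideanSpace.single i t)
        * stdGaussian (EuclideanSpace ℝ (Fin d)) {z | t < 2 * √η * |z i|}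
      ≤ hZZ P (awgn d η) t i 2 := by
  set m : Measure (EuclideanSpace ℝ (Fin d)) := a • volume.withDensity fun x =>
    min (Q.rnDeriv volume x) (Q.rnDeriv volume (x + EuclideanSpace.single i t)) with hm
  have hmass : m Set.univ = a * overlap Q (EuclideanSpace.single i t) := by
    rw [hm, Measure.smul_apply, withDensity_apply _ MeasurableSet.univ, Measure.restrict_univ]
    rfl
  have hshift : ∀ v, a • shiftLaw Q v ≤ shiftLaw P v := fun v => by
    rw [shiftLaw, shiftLaw, ← Measure.map_smul]
    exact Measure.map_mono hPQ (by fun_prop)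
  have hdom : ∀ k, m ≤ shiftLaw P (axisPair i t k) := by
    intro k
    refine le_trans ?_ (hshift _)
    rw [shiftLaw_eq_withDensity Q hQ, hm]
    refine Measure.le_iff.2 fun s _ => ?_
    rw [Measure.smul_apply, Measure.smul_apply]
    refine mul_le_mul_right (withDensity_mono (ae_of_all _ fun x => ?_) s) _
    fin_cases k
    · have h0 : axisPair i t 0 = 0 := by ext j; simp [axisPair]
      simp [h0]
    · simp [axisPair]
  refine le_trans ?_ (le_iSup₂ (axisPair i t) fun k => by simp [axisPair])
  refine le_trans ?_ (lintegral_mono fun x => minErrorProb_awgn_ge hη x _ i ht)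
  rw [lintegral_mul_const, ← hmass]
  · exact mul_le_mul_left (measure_univ_le_lintegral_min_priorU P _ hdom) _
  · exact (Measure.measurable_rnDeriv _ _).min (Measure.measurable_rnDeriv _ _)

/-- If the overlap is at least `c` for all shifts below `δ`, then the `i`-th term of the Ziv-Zakai
bound is at least a truncated second moment of `√η Z_i`. -/
lemma ZZ_awgn_term_ge {d : ℕ} {a c : ℝ≥0∞} (P Q : Measure (EuclideanSpace ℝ (Fin d)))
    [IsFiniteMeasure P] [IsFiniteMeasure Q] (hQ : Q ≪ volume) (hPQ : a • Q ≤ P) {η : ℝ}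
    (hη : 0 < η) (i : Fin d) {δ : ℝ} (hδ : 0 < δ)
    (hc : ∀ t, 0 < t → t < δ → c ≤ overlap Q (EuclideanSpace.single i t)) :
    a * c * ∫⁻ z, ENNReal.ofReal (min (√η * |z i|) (δ / 2) ^ 2)
        ∂(stdGaussian (EuclideanSpace ℝ (Fin d)))
      ≤ ∫⁻ t in Set.Ioi (0 : ℝ), ENNReal.ofReal (t / 2) * hZZ P (awgn d η) t i 2 := by
  set γ := stdGaussian (EuclideanSpace ℝ (Fin d)) with hγ
  set W : EuclideanSpace ℝ (Fin d) → ℝ := fun z => min (√η * |z i|) (δ / 2) with hW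
  have hW0 : ∀ z, 0 ≤ W z := fun z => le_min (by positivity) (by positivity)
  rw [← lintegral_half_mul_meas_le γ (f := W) (by fun_prop)]
  refine (lintegral_const_mul_le _ _).trans (lintegral_mono_ae ?_)
  filter_upwards [ae_restrict_mem measurableSet_Ioi,
    meas_le_ae_eq_meas_lt γ (volume.restrict (Set.Ioi 0)) (fun z => 2 * W z)] with t ht0 hlt
  have ht : 0 < t := ht0
  have hset : {z | t / 2 ≤ |W z|} = {z | t ≤ 2 * W z} := by
    ext z
    simp only [Set.mem_ofPred_eq, abs_of_nonneg (hW0 z)]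
    constructor <;> intro h <;> linarith
  rw [hset, hlt, mul_left_comm]
  refine mul_le_mul_right ?_ _
  by_cases htδ : t < δ
  · refine le_trans ?_ (hZZ_awgn_ge P Q hQ hPQ hη i ht)
    refine mul_le_mul' (mul_le_mul_right (hc t ht htδ) _) (measure_mono fun z hz => ?_)
    simp only [Set.mem_ofPred_eq] at hz ⊢
    linarith [min_le_left (√η * |z i|) (δ / 2)]
  · have hempty : {z | t < 2 * W z} = ∅ := by
      refine Set.eq_empty_of_forall_notMem fun z hz => ?_
      simp only [Set.mem_ofPred_eq] at hz
      linarith [min_le_right (√η * |z i|) (δ / 2)]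
    rw [hempty, measure_empty, mul_zero]
    exact zero_le

lemma tendsto_truncated_second_moment {d : ℕ} (i : Fin d) {δ : ℝ} (hδ : 0 < δ) :
    Tendsto (fun η : ℝ => (∫⁻ z, ENNReal.ofReal (min (√η * |z i|) (δ / 2) ^ 2)
        ∂(stdGaussian (EuclideanSpace ℝ (Fin d)))) / ENNReal.ofReal η) (𝓝[>] 0) (𝓝 1) := by
  set γ := stdGaussian (EuclideanSpace ℝ (Fin d)) with hγ
  have hm : ∀ η : ℝ, Measurable fun z : EuclideanSpace ℝ (Fin d) =>
      ENNReal.ofReal (min (√η * |z i|) (δ / 2) ^ 2) := fun η => by fun_prop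
  have hdiv : ∀ η : ℝ, (∫⁻ z, ENNReal.ofReal (min (√η * |z i|) (δ / 2) ^ 2) ∂γ) / ENNReal.ofReal η
      = ∫⁻ z, ENNReal.ofReal (min (√η * |z i|) (δ / 2) ^ 2) / ENNReal.ofReal η ∂γ := fun η => by
    simp only [div_eq_mul_inv]
    rw [lintegral_mul_const _ (by simpa only [div_eq_mul_inv] using hm η)]
  simp only [hdiv]
  have hscale : ∀ η : ℝ, 0 < η → ∀ z : EuclideanSpace ℝ (Fin d),
      ENNReal.ofReal ((√η * |z i|) ^ 2) = ENNReal.ofReal (z i ^ 2) * ENNReal.ofReal η := by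
    intro η hη z
    rw [mul_pow, Real.sq_sqrt hη.le, sq_abs, ENNReal.ofReal_mul hη.le, mul_comm]
  rw [← lintegral_sq_eval_stdGaussian i]
  refine tendsto_lintegral_filter_of_dominated_convergence
    (fun z => ENNReal.ofReal (z i ^ 2)) (Eventually.of_forall fun η => (hm η).div_const _) ?_ ?_ ?_
  · filter_upwards [self_mem_nhdsWithin] with η hη
    refine ae_of_all _ fun z => ENNReal.div_le_of_le_mul ?_
    rw [← hscale η hη]
    refine ENNReal.ofReal_le_ofReal (pow_le_pow_left₀ ?_ (min_le_left _ _) 2)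
    exact le_min (by positivity) (by positivity)
  · rw [lintegral_sq_eval_stdGaussian]; exact ENNReal.one_ne_top
  · refine ae_of_all _ fun z => tendsto_const_nhds.congr' ?_
    have hsmall : Tendsto (fun η : ℝ => √η * |z i|) (𝓝[>] 0) (𝓝 (√0 * |z i|)) :=
      (Continuous.tendsto (by fun_prop) 0).mono_left nhdsWithin_le_nhds
    filter_upwards [hsmall.eventually_le_const (show √0 * |z i| < δ / 2 by simpa using hδ),
      self_mem_nhdsWithin] with η h hη
    rw [min_eq_left h, hscale η hη, ENNReal.mul_div_cancel_right (by simpa using hη) (by simp)]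

/-- An absolutely continuous component of mass `a` contributes at least `a d η` to the Ziv-Zakai
bound in the low-noise limit. -/
theorem le_liminf_ZZ_awgn {d : ℕ} {a : ℝ≥0∞} (ha : a ≠ ∞)
    (P Q : Measure (EuclideanSpace ℝ (Fin d)))
    [IsFiniteMeasure P] [IsProbabilityMeasure Q] (hQ : Q ≪ volume) (hPQ : a • Q ≤ P) :
    d * a ≤ liminf (fun η : ℝ => ZZ P (awgn d η) 2 / ENNReal.ofReal η) (𝓝[>] 0) := by
  set γ := stdGaussian (EuclideanSpace ℝ (Fin d)) with hγ
  have hstep : ∀ c : ℝ≥0∞, c < 1 →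
      d * (a * c) ≤ liminf (fun η : ℝ => ZZ P (awgn d η) 2 / ENNReal.ofReal η) (𝓝[>] 0) := by
    intro c hc
    have hδ : ∀ i : Fin d, ∃ δ : ℝ, 0 < δ ∧
        ∀ t, 0 < t → t < δ → c ≤ overlap Q (EuclideanSpace.single i t) := by
      intro i
      have hlim : Tendsto (fun t : ℝ => EuclideanSpace.single i t) (𝓝[>] 0)
          (𝓝 (0 : EuclideanSpace ℝ (Fin d))) := by
        have h : Continuous fun t : ℝ => (EuclideanSpace.single i t : EuclideanSpace ℝ (Fin d)) :=
          (LinearMap.continuous_of_finiteDimensional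
            (LinearMap.toSpanSingleton ℝ _ (EuclideanSpace.single i (1 : ℝ)))).congr fun t => by
              ext j; simp
        have h0 := (h.tendsto 0).mono_left (nhdsWithin_le_nhds (s := Set.Ioi 0))
        have hz : (EuclideanSpace.single i (0 : ℝ) : EuclideanSpace ℝ (Fin d)) = 0 := by
          ext j; simp
        rwa [hz] at h0
      obtain ⟨δ, hδ, hsub⟩ := (mem_nhdsGT_iff_exists_Ioo_subset).1
        (hlim.eventually (eventually_le_overlap Q hQ hc))
      exact ⟨δ, hδ, fun t h1 h2 => hsub ⟨h1, h2⟩⟩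
    choose δ hδ0 hδ using hδ
    have hlim := tendsto_finsetSum Finset.univ fun (i : Fin d) _ =>
      ENNReal.Tendsto.const_mul (a := a * c) (tendsto_truncated_second_moment i (hδ0 i))
        (Or.inr (ENNReal.mul_ne_top ha (hc.trans ENNReal.one_lt_top).ne))
    simp only [mul_one, Finset.sum_const, Finset.card_univ, Fintype.card_fin, nsmul_eq_mul] at hlim
    rw [← hlim.liminf_eq]
    refine liminf_le_liminf ?_
    filter_upwards [self_mem_nhdsWithin] with η hη
    rw [ZZ, div_eq_mul_inv, Finset.sum_mul]
    refine Finset.sum_le_sum fun i _ => ?_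
    rw [← mul_div_assoc, div_eq_mul_inv]
    refine mul_le_mul_left ?_ _
    simp only [natCast_two_sub_one, div_one]
    exact ZZ_awgn_term_ge P Q hQ hPQ hη i (hδ0 i) (hδ i)
  have hlim : Tendsto (fun c : ℝ≥0∞ => d * (a * c)) (𝓝[<] 1) (𝓝 (d * (a * 1))) := by
    refine Tendsto.mono_left ?_ nhdsWithin_le_nhds
    exact ENNReal.Tendsto.const_mul (ENNReal.Tendsto.const_mul tendsto_id (Or.inr ha))
      (Or.inr (by simp))
  rw [mul_one] at hlim
  have hne : (𝓝[<] (1 : ℝ≥0∞)).NeBot := nhdsLT_neBot_of_exists_lt ⟨0, one_pos⟩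
  exact le_of_tendsto hlim (eventually_nhdsWithin_of_forall hstep)

end ZivZakai

theorem theorem3 (d : ℕ) (α : ℝ) (hα0 : 0 ≤ α) (hα1 : α ≤ 1)
    (P PC PD : Measure (EuclideanSpace ℝ (Fin d)))
    [IsProbabilityMeasure P] [IsProbabilityMeasure PC] [IsProbabilityMeasure PD]
    (hC : PC ≪ volume) (hD : ZivZakai.IsPurelyDiscrete PD)
    (hP : P = ENNReal.ofReal α • PC + ENNReal.ofReal (1 - α) • PD) :
    Tendsto (fun η : ℝ => ZivZakai.ZZ P (ZivZakai.awgn d η) 2 / ENNReal.ofReal η)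
        (𝓝[>] 0) (𝓝 (ENNReal.ofReal (α * d))) ∧
      Tendsto (fun η : ℝ => ZivZakai.mmse P (ZivZakai.awgn d η) / ENNReal.ofReal η)
        (𝓝[>] 0) (𝓝 (ENNReal.ofReal (α * d))) := by
  have hval : ENNReal.ofReal (α * d) = d * ENNReal.ofReal α := by
    rw [ENNReal.ofReal_mul hα0, ENNReal.ofReal_natCast, mul_comm]
  have hle : ∀ η : ℝ, ZivZakai.ZZ P (ZivZakai.awgn d η) 2 / ENNReal.ofReal η
      ≤ ZivZakai.mmse P (ZivZakai.awgn d η) / ENNReal.ofReal η := fun η =>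
    ENNReal.div_le_div_right (ZivZakai.ZZ_two_le_mmse P _) _
  -- Both limits are squeezed in `αd ≤ liminf ZZ/η ≤ liminf mmse/η`,
  -- `limsup ZZ/η ≤ limsup mmse/η ≤ αd`.
  have hlower := ZivZakai.le_liminf_ZZ_awgn ENNReal.ofReal_ne_top P PC hC
    (hP ▸ Measure.le_add_right le_rfl : ENNReal.ofReal α • PC ≤ P)
  have hupper : limsup (fun η : ℝ => ZivZakai.mmse P (ZivZakai.awgn d η) / ENNReal.ofReal η)
      (𝓝[>] 0) ≤ d * ENNReal.ofReal α := by
    obtain ⟨S, hS, hDS⟩ := hD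
    refine (ZivZakai.limsup_mmse_awgn_le P hS).trans (mul_le_mul_right ?_ _)
    rw [hP]
    simp only [Measure.add_apply, Measure.smul_apply, smul_eq_mul, hDS, mul_zero, add_zero]
    exact mul_le_of_le_one_right' prob_le_one
  rw [hval]
  exact ⟨tendsto_of_le_liminf_of_limsup_le hlower
      ((limsup_le_limsup (Eventually.of_forall hle)).trans hupper),
    tendsto_of_le_liminf_of_limsup_le
      (hlower.trans (liminf_le_liminf (Eventually.of_forall hle))) hupper⟩
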